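/- **Setting.** Let $(\Omega,\Sigma,\mu)$ be a $\sigma$-finite measure space and $\mathcal A\subseteq\Sigma$ a $\sigma$-subalgebra such that $(\Omega,\mathcal A,\mu)$ is also $\sigma$-finite. Sets and functions are identified when they agree up to a $\mu$-null set. *Young functions.* Let $\Phi:\mathbb R\to\mathbb R$ be a Young function, i.e. $\Phi$ is continuous, convex and even, $\Phi(x)=0$ if and only if $x=0$, and $\Phi(x)/x\to\infty$, $\Phi(x)\to\infty$ as $x\to\infty$. Put $\Phi^*(y)=\sup\{x|y|-\Phi(x):x\ge 0\}$ for $y\in\mathbb R$. For $\varphi\in\{\Phi,\Phi^*\}$ and $y\in[0,\infty]$ let $\varphi^{-1}(y)=\sup\{t\ge 0:\varphi(t)\le y\}\in[0,\infty]$; this is the ordinary inverse on $[0,\infty)$ when $\varphi$ is strictly increasing there, and $\varphi^{-1}(\infty)=\infty$. *Orlicz spaces.* For $\varphi\in\{\Phi,\Phi^*\}$, $L^{\varphi}(\Sigma)$ is the set of measurable $f:\Omega\to\mathbb C$ with $\int_\Omega\varphi(k|f|)\,d\mu<\infty$ for some $k>0$; $L^\Phi(\Sigma)$ carries the norm $N_\Phi(f)=\inf\{k>0:\int_\Omega\Phi(|f|/k)\,d\mu\le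 1\}$. *Conditional expectation.* For measurable $f:\Omega\to[0,\infty]$, $E(f)$ is the unique $\mathcal A$-measurable $[0,\infty]$-valued function with $\int_A f\,d\mu=\int_A E(f)\,d\mu$ for all $A\in\mathcal A$. A measurable $f:\Omega\to\mathbb C$ is *conditionable* if $E(|f|)<\infty$ a.e.; then $E(f)$ is defined by linearity from the positive and negative parts of $\operatorname{Re}f$ and $\operatorname{Im}f$. *The operator.* Let $u:\Omega\to\mathbb C$ be $\Sigma$-measurable and assume that for every $f\in L^\Phi(\Sigma)$ the function $uf$ is conditionable, that $E(uf)\in L^\Phi(\Sigma)$, and that $R_u f=E(uf)$ defines a bounded linear operator on $L^\Phi(\Sigma)$. (Then $u$ itself is conditionable.) Its essential norm is $\|R_u\|_e=\inf\{\|R_u-S\|: S \text{ a compact operator on } L^\Phi(\Sigma)\}$. *GCH-inequality.* The pair $(E,\Phi)$ satisfies the generalized conditional-type Hölder inequality (GCH-inequality) with constant $C>0$ if for all $f\in L^\Phi(\Sigma)$ and $g\in L^{\Phi^*}(\Sigma)$ $$E(|fg|)\le C\,\Phi^{-1}\big(E(\Phi(|f|))\big)\,\Phi^{*-1}\big(E(\Phi^*(|g|))\big)\quad\text{a.e.}$$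 *Atoms.* An $\mathcal A$-atom is a set $A\in\mathcal A$ with $\mu(A)>0$ such that every $F\in\mathcal A$ with $F\subseteq A$ has $\mu(F)=0$ or $\mu(F)=\mu(A)$. A set "consists of finitely many $\mathcal A$-atoms" if, up to a null set, it is a finite (possibly empty) union of $\mathcal A$-atoms. Let $(A_n)$ be the finite or countable family of pairwise disjoint $\mathcal A$-atoms that contains every $\mathcal A$-atom up to a null set, and let $a_n=\mu(A_n)$. (If there are only finitely many atoms, the condition on $(a_n)$ in (b) counts as satisfied.) **Theorem 3.3.** In this setting the following hold, where an infimum over the empty set is $\infty$. (a) If $(E,\Phi)$ satisfies the GCH-inequality with constant $C>0$, then $$\|R_u\|_e\le C\beta_2,$$ where $\beta_2$ is the infimum of the $\varepsilon>0$ for which $\{w\in\Omega:\Phi^{*-1}(E(\Phi^*(|u|)))(w)\ge\varepsilon\}$ consists of finitely many $\mathcal A$-atoms. (b) If $a_n\to 0$, or if $(a_n)$ has no subsequence that converges to a finite limit, then $$\|R_u\|_e\ge\beta_1,$$ where $\beta_1$ is the infimum of the $\varepsilon>0$ for which $\{w\in\Omega:|E(u)(w)|\ge\varepsilon\}$ consists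 of finitely many $\mathcal A$-atoms. -/

import Mathlib

open MeasureTheory Filter Topology Set
open scoped ENNReal NNReal

noncomputable section

namespace Orlicz

/-! ### Young functions -/

/-- A Young function: continuous, convex and even, vanishing exactly at `0`, and
superlinear at infinity. -/
structure YoungFunction where
  toFun : ℝ → ℝ
  continuous_toFun : Continuous toFun
  convexOn_toFun : ConvexOn ℝ univ toFun
  eq_zero_iff : ∀ x, toFun x = 0 ↔ x = 0
  even_toFun : ∀ x, toFun (-x) = toFun x
  tendsto_div : Tendsto (fun x => toFun x / x) atTop atTop
  tendsto_toFun : Tendsto toFun atTop atTop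

instance : CoeFun YoungFunction (fun _ => ℝ → ℝ) := ⟨YoungFunction.toFun⟩

/-- The complementary function `φ*(y) = sup {x |y| - φ(x) : x ≥ 0}`
(a finite supremum when `φ` is a Young function). -/
def complementary (φ : ℝ → ℝ) (y : ℝ) : ℝ :=
  sSup ((fun x : ℝ => x * |y| - φ x) '' Ici 0)

/-- The inverse on `[0, ∞]` of (the restriction to `[0, ∞)` of) an increasing function:
`φ⁻¹(y) = sup {t ≥ 0 : φ(t) ≤ y}`, so that `φ⁻¹(∞) = ∞`. It is the usual inverse where `φ` is
strictly increasing, and the usual right-continuous generalized inverse otherwise (a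
complementary function may vanish on an interval `[0, t₀]`). -/
def youngInv (φ : ℝ → ℝ) (y : ℝ≥0∞) : ℝ≥0∞ :=
  ⨆ (t : ℝ≥0) (_ : ENNReal.ofReal (φ t) ≤ y), (t : ℝ≥0∞)

namespace YoungFunction

variable (Φ : YoungFunction)

theorem map_zero : Φ 0 = 0 := (Φ.eq_zero_iff 0).2 rfl

theorem nonneg (x : ℝ) : 0 ≤ Φ x := by
  have h := Φ.convexOn_toFun.2 (mem_univ x) (mem_univ (-x))
    (by norm_num : (0 : ℝ) ≤ 1 / 2) (by norm_num : (0 : ℝ) ≤ 1 / 2) (by norm_num)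
  have e : (1 / 2 : ℝ) • x + (1 / 2 : ℝ) • (-x) = 0 := by simp
  rw [e, Φ.map_zero, Φ.even_toFun] at h
  simp only [smul_eq_mul] at h
  linarith

theorem map_mul_le {t : ℝ} (ht0 : 0 ≤ t) (ht1 : t ≤ 1) (x : ℝ) : Φ (t * x) ≤ t * Φ x := by
  have h := Φ.convexOn_toFun.2 (mem_univ x) (mem_univ 0) ht0 (sub_nonneg.2 ht1) (by ring)
  simpa [Φ.map_zero] using h

theorem mono {x y : ℝ} (hx : 0 ≤ x) (hxy : x ≤ y) : Φ x ≤ Φ y := by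
  rcases hx.eq_or_lt with rfl | hx0
  · rw [Φ.map_zero]; exact Φ.nonneg y
  have hy : 0 < y := hx0.trans_le hxy
  have h := Φ.map_mul_le (div_nonneg hx hy.le) ((div_le_one hy).2 hxy) y
  rw [div_mul_cancel₀ _ hy.ne'] at h
  exact h.trans (mul_le_of_le_one_left (Φ.nonneg y) ((div_le_one hy).2 hxy))

theorem measurable_comp {Ω : Type*} [MeasurableSpace Ω] {μ : Measure Ω} (f : Ω →ₘ[μ] ℂ)
    (k : ℝ) : AEMeasurable (fun ω => ENNReal.ofReal (Φ (k * ‖f ω‖))) μ := by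
  have h : AEMeasurable (fun ω => ‖f ω‖) μ := f.aestronglyMeasurable.norm.aemeasurable
  exact (Φ.continuous_toFun.measurable.comp_aemeasurable (h.const_mul k)).ennreal_ofReal

end YoungFunction

/-! ### Orlicz spaces -/

section Space

variable {Ω : Type*} [MeasurableSpace Ω]

/-- The function `f` is measurable and `∫ φ(k|f|) dμ < ∞` for some `k > 0`. -/
def MemOrlicz (φ : ℝ → ℝ) (μ : Measure Ω) (f : Ω → ℂ) : Prop :=
  AEStronglyMeasurable f μ ∧ ∃ k : ℝ, 0 < k ∧ ∫⁻ ω, ENNReal.ofReal (φ (k * ‖f ω‖)) ∂μ < ∞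

variable (Φ : YoungFunction) {μ : Measure Ω}

theorem lintegral_mono_scale {f : Ω → ℂ} {k l : ℝ} (hk : 0 ≤ k) (hkl : k ≤ l) :
    ∫⁻ ω, ENNReal.ofReal (Φ (k * ‖f ω‖)) ∂μ ≤ ∫⁻ ω, ENNReal.ofReal (Φ (l * ‖f ω‖)) ∂μ :=
  lintegral_mono fun _ => ENNReal.ofReal_le_ofReal
    (Φ.mono (mul_nonneg hk (norm_nonneg _)) (mul_le_mul_of_nonneg_right hkl (norm_nonneg _)))

/-- Convexity of the modular, with the weights `a/(a+b)` and `b/(a+b)`. -/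
theorem lintegral_add_le (f g : Ω →ₘ[μ] ℂ) {a b : ℝ} (ha : 0 < a) (hb : 0 < b) :
    ∫⁻ ω, ENNReal.ofReal (Φ ((a + b)⁻¹ * ‖(f + g : Ω →ₘ[μ] ℂ) ω‖)) ∂μ ≤
      ENNReal.ofReal (a / (a + b)) * ∫⁻ ω, ENNReal.ofReal (Φ (a⁻¹ * ‖f ω‖)) ∂μ +
      ENNReal.ofReal (b / (a + b)) * ∫⁻ ω, ENNReal.ofReal (Φ (b⁻¹ * ‖g ω‖)) ∂μ := by
  have hab : 0 < a + b := add_pos ha hb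
  rw [← lintegral_const_mul'' _ (Φ.measurable_comp f _),
    ← lintegral_const_mul'' _ (Φ.measurable_comp g _),
    ← lintegral_add_left' ((Φ.measurable_comp f _).const_mul _)]
  refine lintegral_mono_ae ?_
  filter_upwards [AEEqFun.coeFn_add f g] with ω hω
  rw [← ENNReal.ofReal_mul (by positivity), ← ENNReal.ofReal_mul (by positivity),
    ← ENNReal.ofReal_add (mul_nonneg (by positivity) (Φ.nonneg _))
      (mul_nonneg (by positivity) (Φ.nonneg _))]
  refine ENNReal.ofReal_le_ofReal ?_
  have h := Φ.convexOn_toFun.2 (mem_univ (a⁻¹ * ‖f ω‖)) (mem_univ (b⁻¹ * ‖g ω‖))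
    (by positivity : 0 ≤ a / (a + b)) (by positivity : 0 ≤ b / (a + b)) (by field_simp)
  simp only [smul_eq_mul] at h
  refine (Φ.mono (by positivity) ?_).trans h
  rw [hω, Pi.add_apply]
  have e : a / (a + b) * (a⁻¹ * ‖f ω‖) + b / (a + b) * (b⁻¹ * ‖g ω‖)
      = (a + b)⁻¹ * (‖f ω‖ + ‖g ω‖) := by field_simp
  rw [e]
  exact mul_le_mul_of_nonneg_left (norm_add_le _ _) (by positivity)

theorem lintegral_smul (c : ℂ) (f : Ω →ₘ[μ] ℂ) (k : ℝ) :
    ∫⁻ ω, ENNReal.ofReal (Φ (k * ‖(c • f : Ω →ₘ[μ] ℂ) ω‖)) ∂μ =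
      ∫⁻ ω, ENNReal.ofReal (Φ ((k * ‖c‖) * ‖f ω‖)) ∂μ := by
  refine lintegral_congr_ae ?_
  filter_upwards [AEEqFun.coeFn_smul c f] with ω hω
  rw [hω, Pi.smul_apply, norm_smul, mul_assoc]

variable (μ)

/-- The Orlicz space `L^Φ(μ)` of (classes of) complex functions `f` with `∫ Φ(k|f|) dμ < ∞`
for some `k > 0`. -/
def OrliczSpace : Submodule ℂ (Ω →ₘ[μ] ℂ) where
  carrier := {f | MemOrlicz Φ μ f}
  zero_mem' := by
    refine ⟨AEEqFun.aestronglyMeasurable _, 1, one_pos, ?_⟩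
    have h : ∀ᵐ ω ∂μ, ENNReal.ofReal (Φ (1 * ‖(0 : Ω →ₘ[μ] ℂ) ω‖)) = 0 := by
      filter_upwards [AEEqFun.coeFn_zero (α := Ω) (β := ℂ) (μ := μ)] with ω hω
      simp [hω, Φ.map_zero]
    rw [lintegral_congr_ae h]
    simp
  add_mem' := by
    rintro f g ⟨_, k, hk, hf⟩ ⟨_, l, hl, hg⟩
    refine ⟨AEEqFun.aestronglyMeasurable _, (k⁻¹ + l⁻¹)⁻¹, by positivity, ?_⟩
    refine (lintegral_add_le Φ f g (inv_pos.2 hk) (inv_pos.2 hl)).trans_lt ?_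
    rw [inv_inv, inv_inv]
    exact ENNReal.add_lt_top.2 ⟨ENNReal.mul_lt_top ENNReal.ofReal_lt_top hf,
      ENNReal.mul_lt_top ENNReal.ofReal_lt_top hg⟩
  smul_mem' := by
    rintro c f ⟨_, k, hk, hf⟩
    have hc : 0 < ‖c‖ + 1 := by positivity
    refine ⟨AEEqFun.aestronglyMeasurable _, k / (‖c‖ + 1), by positivity, ?_⟩
    rw [lintegral_smul]
    refine (lintegral_mono_scale Φ (by positivity) ?_).trans_lt hf
    rw [div_mul_eq_mul_div, div_le_iff₀ hc]
    nlinarith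

variable {μ}

/-- The Luxemburg norm `N_Φ(f) = inf {k > 0 : ∫ Φ(|f|/k) dμ ≤ 1}`. -/
instance : Norm (OrliczSpace Φ μ) where
  norm f := sInf {k : ℝ | 0 < k ∧ ∫⁻ ω, ENNReal.ofReal (Φ (‖(f : Ω →ₘ[μ] ℂ) ω‖ / k)) ∂μ ≤ 1}

variable {Φ}

theorem norm_def (f : OrliczSpace Φ μ) :
    ‖f‖ = sInf {k : ℝ | 0 < k ∧
      ∫⁻ ω, ENNReal.ofReal (Φ (k⁻¹ * ‖(f : Ω →ₘ[μ] ℂ) ω‖)) ∂μ ≤ 1} := by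
  simp only [← div_eq_inv_mul]
  rfl

theorem norm_nonneg' (f : OrliczSpace Φ μ) : 0 ≤ ‖f‖ := by
  rw [norm_def]
  exact Real.sInf_nonneg fun k hk => hk.1.le

theorem norm_le_of_lintegral_le {f : OrliczSpace Φ μ} {k : ℝ} (hk : 0 < k)
    (h : ∫⁻ ω, ENNReal.ofReal (Φ (k⁻¹ * ‖(f : Ω →ₘ[μ] ℂ) ω‖)) ∂μ ≤ 1) : ‖f‖ ≤ k := by
  rw [norm_def]
  exact csInf_le ⟨0, fun k hk => hk.1.le⟩ ⟨hk, h⟩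

theorem exists_lintegral_le (f : OrliczSpace Φ μ) : ∃ k : ℝ, 0 < k ∧
    ∫⁻ ω, ENNReal.ofReal (Φ (k⁻¹ * ‖(f : Ω →ₘ[μ] ℂ) ω‖)) ∂μ ≤ 1 := by
  obtain ⟨f, _, k, hk, hf⟩ := f
  set I := ∫⁻ ω, ENNReal.ofReal (Φ (k * ‖f ω‖)) ∂μ with hI
  set M : ℝ := I.toReal + 1 with hM
  have hM1 : 1 ≤ M := by have := I.toReal_nonneg; linarith
  have hM0 : 0 < M := by linarith
  refine ⟨M / k, by positivity, ?_⟩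
  calc ∫⁻ ω, ENNReal.ofReal (Φ ((M / k)⁻¹ * ‖f ω‖)) ∂μ
      ≤ ∫⁻ ω, ENNReal.ofReal M⁻¹ * ENNReal.ofReal (Φ (k * ‖f ω‖)) ∂μ := by
        refine lintegral_mono fun ω => ?_
        rw [← ENNReal.ofReal_mul (by positivity)]
        refine ENNReal.ofReal_le_ofReal ?_
        have h := Φ.map_mul_le (inv_nonneg.2 hM0.le) (inv_le_one_of_one_le₀ hM1) (k * ‖f ω‖)
        have e : (M / k)⁻¹ * ‖f ω‖ = M⁻¹ * (k * ‖f ω‖) := by field_simp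
        rwa [e]
    _ = ENNReal.ofReal M⁻¹ * I := lintegral_const_mul'' _ (Φ.measurable_comp f k)
    _ ≤ ENNReal.ofReal M⁻¹ * ENNReal.ofReal M := by
        gcongr
        rw [← ENNReal.ofReal_toReal hf.ne]
        exact ENNReal.ofReal_le_ofReal (by linarith)
    _ = 1 := by
        rw [← ENNReal.ofReal_mul (by positivity), inv_mul_cancel₀ hM0.ne', ENNReal.ofReal_one]

theorem lintegral_le_of_norm_lt {f : OrliczSpace Φ μ} {k : ℝ} (h : ‖f‖ < k) :
    ∫⁻ ω, ENNReal.ofReal (Φ (k⁻¹ * ‖(f : Ω →ₘ[μ] ℂ) ω‖)) ∂μ ≤ 1 := by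
  rw [norm_def] at h
  obtain ⟨l, ⟨hl, hi⟩, hlk⟩ := exists_lt_of_csInf_lt (exists_lintegral_le f) h
  exact (lintegral_mono_scale Φ (inv_nonneg.2 (hl.trans hlk).le)
    (inv_anti₀ hl hlk.le)).trans hi

theorem norm_add_le' (f g : OrliczSpace Φ μ) : ‖f + g‖ ≤ ‖f‖ + ‖g‖ := by
  refine le_of_forall_pos_le_add fun ε hε => ?_
  have hf := norm_nonneg' f
  have hg := norm_nonneg' g
  have ha : 0 < ‖f‖ + ε / 2 := by linarith
  have hb : 0 < ‖g‖ + ε / 2 := by linarith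
  have e : ‖f‖ + ‖g‖ + ε = (‖f‖ + ε / 2) + (‖g‖ + ε / 2) := by ring
  rw [e]
  refine norm_le_of_lintegral_le (add_pos ha hb) ?_
  refine (lintegral_add_le Φ (f : Ω →ₘ[μ] ℂ) (g : Ω →ₘ[μ] ℂ) ha hb).trans ?_
  refine (add_le_add
    (mul_le_mul_right (lintegral_le_of_norm_lt (f := f) (k := ‖f‖ + ε / 2) (by linarith)) _)
    (mul_le_mul_right
      (lintegral_le_of_norm_lt (f := g) (k := ‖g‖ + ε / 2) (by linarith)) _)).trans ?_
  rw [mul_one, mul_one, ← ENNReal.ofReal_add (by positivity) (by positivity), ← add_div,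
    div_self (add_pos ha hb).ne', ENNReal.ofReal_one]

theorem norm_smul_le' (c : ℂ) (f : OrliczSpace Φ μ) : ‖c • f‖ ≤ ‖c‖ * ‖f‖ := by
  refine le_of_forall_pos_le_add fun ε hε => ?_
  have hf := norm_nonneg' f
  have hc := norm_nonneg c
  have hk : 0 < ‖c‖ * ‖f‖ + ε := by positivity
  refine norm_le_of_lintegral_le hk ?_
  have h1 := lintegral_smul Φ c (f : Ω →ₘ[μ] ℂ) (‖c‖ * ‖f‖ + ε)⁻¹
  refine h1.le.trans ?_
  have hl : ‖f‖ < ‖f‖ + ε / (‖c‖ + 1) := by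
    have : 0 < ε / (‖c‖ + 1) := by positivity
    linarith
  refine (lintegral_mono_scale Φ (by positivity) ?_).trans (lintegral_le_of_norm_lt hl)
  rw [inv_mul_eq_div, div_le_iff₀ hk, ← div_eq_inv_mul, le_div_iff₀ (hf.trans_lt hl)]
  have : ‖c‖ * (ε / (‖c‖ + 1)) ≤ ε := by
    rw [mul_div_assoc', div_le_iff₀ (by positivity)]
    nlinarith
  nlinarith

theorem norm_zero' : ‖(0 : OrliczSpace Φ μ)‖ = 0 := by
  have h := norm_smul_le' (0 : ℂ) (0 : OrliczSpace Φ μ)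
  rw [smul_zero, norm_zero, zero_mul] at h
  exact le_antisymm h (norm_nonneg' _)

theorem eq_zero_of_norm_eq_zero {f : OrliczSpace Φ μ} (h : ‖f‖ = 0) : f = 0 := by
  have hn : ∀ n : ℕ, ENNReal.ofReal (n + 1) *
      ∫⁻ ω, ENNReal.ofReal (Φ (1 * ‖(f : Ω →ₘ[μ] ℂ) ω‖)) ∂μ ≤ 1 := by
    intro n
    have hp : (0 : ℝ) < (n : ℝ) + 1 := by positivity
    have h1 := lintegral_le_of_norm_lt (f := f) (k := ((n : ℝ) + 1)⁻¹) (by rw [h]; positivity)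
    refine le_trans ?_ h1
    rw [← lintegral_const_mul'' _ (Φ.measurable_comp _ _)]
    refine lintegral_mono fun ω => ?_
    rw [← ENNReal.ofReal_mul hp.le, inv_inv, one_mul]
    refine ENNReal.ofReal_le_ofReal ?_
    have h2 := Φ.map_mul_le (inv_nonneg.2 hp.le)
      (inv_le_one_of_one_le₀ (by have : (0 : ℝ) ≤ n := n.cast_nonneg; linarith))
      (((n : ℝ) + 1) * ‖(f : Ω →ₘ[μ] ℂ) ω‖)
    rw [inv_mul_cancel_left₀ hp.ne', inv_mul_eq_div, le_div_iff₀ hp] at h2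
    linarith
  have hI : ∫⁻ ω, ENNReal.ofReal (Φ (1 * ‖(f : Ω →ₘ[μ] ℂ) ω‖)) ∂μ = 0 := by
    by_contra hne
    obtain ⟨n, hn'⟩ := ENNReal.exists_nat_mul_gt hne ENNReal.one_ne_top
    refine absurd (hn n) (not_le.2 (hn'.trans_le ?_))
    gcongr
    rw [← ENNReal.ofReal_natCast]
    exact ENNReal.ofReal_le_ofReal (by linarith)
  rw [lintegral_eq_zero_iff' (Φ.measurable_comp _ _)] at hI
  refine Subtype.ext (AEEqFun.ext ?_)
  filter_upwards [hI, AEEqFun.coeFn_zero (α := Ω) (β := ℂ) (μ := μ)] with ω hω h0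
  have h1 : Φ (1 * ‖(f : Ω →ₘ[μ] ℂ) ω‖) = 0 :=
    le_antisymm (ENNReal.ofReal_eq_zero.1 hω) (Φ.nonneg _)
  rw [Φ.eq_zero_iff, one_mul, norm_eq_zero] at h1
  rw [h1]
  exact h0.symm

theorem normedSpaceCore : NormedSpace.Core ℂ (OrliczSpace Φ μ) where
  norm_nonneg := norm_nonneg'
  norm_smul c f := by
    refine le_antisymm (norm_smul_le' c f) ?_
    rcases eq_or_ne c 0 with rfl | hc
    · rw [norm_zero, zero_mul]; exact norm_nonneg' _
    · have h := norm_smul_le' c⁻¹ (c • f)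
      rw [inv_smul_smul₀ hc, norm_inv, inv_mul_eq_div,
        le_div_iff₀ (norm_pos_iff.2 hc)] at h
      linarith
  norm_triangle := norm_add_le'
  norm_eq_zero_iff f := ⟨eq_zero_of_norm_eq_zero, fun h => by rw [h]; exact norm_zero'⟩

instance : NormedAddCommGroup (OrliczSpace Φ μ) := NormedAddCommGroup.ofCore normedSpaceCore

instance : NormedSpace ℂ (OrliczSpace Φ μ) := NormedSpace.ofCore normedSpaceCore

end Space

/-! ### Conditional expectation and weighted conditional type operators

For `[0, ∞]`-valued functions the conditional expectation `E` is `condLExp 𝒜 μ`. -/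

section Conditional

variable {Ω : Type*} (𝒜 : MeasurableSpace Ω) {mΩ : MeasurableSpace Ω}

/-- `f` is conditionable: `E(|f|) < ∞` almost everywhere. -/
def Conditionable (μ : Measure Ω) (f : Ω → ℂ) : Prop :=
  AEStronglyMeasurable f μ ∧ ∀ᵐ ω ∂μ, condLExp 𝒜 μ (fun ω => ‖f ω‖ₑ) ω < ∞

/-- The conditional expectation of a conditionable real function,
`E(f) = E(f⁺) - E(f⁻)`. -/
def condExpReal (μ : Measure Ω) (f : Ω → ℝ) (ω : Ω) : ℝ :=
  (condLExp 𝒜 μ (fun ω => ENNReal.ofReal (f ω)) ω).toReal -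
    (condLExp 𝒜 μ (fun ω => ENNReal.ofReal (-f ω)) ω).toReal

/-- The conditional expectation `E(f) = E(Re f) + i E(Im f)` of a conditionable function. -/
def condExpC (μ : Measure Ω) (f : Ω → ℂ) (ω : Ω) : ℂ :=
  ⟨condExpReal 𝒜 μ (fun ω => (f ω).re) ω, condExpReal 𝒜 μ (fun ω => (f ω).im) ω⟩

/-- The bounded operator `R` on `L^Φ(μ)` is the weighted conditional type operator
`R_u f = E(u f)`: for every `f ∈ L^Φ(μ)`, `u f` is conditionable and `R f = E(u f)`. -/
def IsWCT {Φ : YoungFunction} {μ : Measure Ω} (u : Ω → ℂ)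
    (R : OrliczSpace Φ μ →L[ℂ] OrliczSpace Φ μ) : Prop :=
  ∀ f : OrliczSpace Φ μ,
    Conditionable 𝒜 μ (fun ω => u ω * (f : Ω →ₘ[μ] ℂ) ω) ∧
    ((R f : Ω →ₘ[μ] ℂ) : Ω → ℂ) =ᵐ[μ] condExpC 𝒜 μ (fun ω => u ω * (f : Ω →ₘ[μ] ℂ) ω)

/-- `φ⁻¹(E(φ(|f|)))`, as a `[0, ∞]`-valued function. -/
def condYoung (μ : Measure Ω) (φ : ℝ → ℝ) (f : Ω → ℂ) (ω : Ω) : ℝ≥0∞ :=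
  youngInv φ (condLExp 𝒜 μ (fun ω => ENNReal.ofReal (φ ‖f ω‖)) ω)

/-- `(E, Φ)` satisfies the generalized conditional-type Hölder inequality with constant `C`:
`E(|f g|) ≤ C Φ⁻¹(E(Φ(|f|))) Φ*⁻¹(E(Φ*(|g|)))` for all `f ∈ L^Φ` and `g ∈ L^{Φ*}`. -/
def GCHInequality (μ : Measure Ω) (Φ : YoungFunction) (C : ℝ) : Prop :=
  ∀ f g : Ω → ℂ, MemOrlicz Φ μ f → MemOrlicz (complementary Φ) μ g →
    ∀ᵐ ω ∂μ, condLExp 𝒜 μ (fun ω => ‖f ω * g ω‖ₑ) ω ≤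
      ENNReal.ofReal C * condYoung 𝒜 μ Φ f ω * condYoung 𝒜 μ (complementary Φ) g ω

/-! ### Atoms -/

/-- `A` is an `𝒜`-atom of `μ`. -/
def IsAtomOf (μ : Measure Ω) (A : Set Ω) : Prop :=
  MeasurableSet[𝒜] A ∧ 0 < μ A ∧
    ∀ F, MeasurableSet[𝒜] F → F ⊆ A → μ F = 0 ∨ μ F = μ A

/-- Up to a null set, `N` is the union of finitely many (possibly no) `𝒜`-atoms. -/
def ConsistsOfFinitelyManyAtoms (μ : Measure Ω) (N : Set Ω) : Prop :=
  ∃ S : Finset (Set Ω), (∀ A ∈ S, IsAtomOf 𝒜 μ A) ∧ N =ᵐ[μ] (⋃ A ∈ S, A : Set Ω)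

/-- `A` lists the `𝒜`-atoms of `μ`: the `A i` are pairwise disjoint `𝒜`-atoms, and every
`𝒜`-atom agrees with some `A i` up to a null set. -/
def IsAtomEnumeration (μ : Measure Ω) {ι : Type*} (A : ι → Set Ω) : Prop :=
  (∀ i, IsAtomOf 𝒜 μ (A i)) ∧ Pairwise (fun i j => Disjoint (A i) (A j)) ∧
    ∀ B, IsAtomOf 𝒜 μ B → ∃ i, B =ᵐ[μ] A i

/-- The infimum (`∞` if there is none) of the `ε > 0` for which `{w : h(w) ≥ ε}` consists of
finitely many `𝒜`-atoms. -/
def atomicThreshold (μ : Measure Ω) (h : Ω → ℝ≥0∞) : ℝ≥0∞ :=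
  ⨅ (ε : ℝ≥0) (_ : 0 < ε ∧ ConsistsOfFinitelyManyAtoms 𝒜 μ {ω | (ε : ℝ≥0∞) ≤ h ω}), (ε : ℝ≥0∞)

end Conditional

/-! ### Essential norm -/

/-- The distance, in operator norm, from `T` to the compact operators. -/
def essNorm {X : Type*} [NormedAddCommGroup X] [NormedSpace ℂ X] (T : X →L[ℂ] X) : ℝ :=
  sInf {r : ℝ | ∃ S : X →L[ℂ] X, IsCompactOperator S ∧ r = ‖T - S‖}

end Orlicz

end

/-! Upper bound. Suppose `{Φ*⁻¹(E(Φ*(|u|))) ≥ ε}` is a finite union `U` of `𝒜`-atoms. An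
`𝒜`-measurable function is a.e. constant on an atom, so `1_U R_u` has finite rank, and `‖R_u‖_e ≤
‖1_{Uᶜ} R_u‖`. On `Uᶜ` the GCH-inequality gives `|E(uf)| ≤ E(|uf|) ≤ C ε Φ⁻¹(E(Φ(|f|)))`, i.e.
`Φ(|E(uf)| / (C ε)) ≤ E(Φ(|f|))`. Integrating, a modular of `f` at most `1` forces `‖1_{Uᶜ} R_u f‖ ≤
C ε` (`IsWCT.norm_restrict_le`).

Lower bound. If `{|E(u)| ≥ ε}` is not a finite union of atoms, it contains infinitely many disjoint
`𝒜`-sets `B n` of positive finite measure. On functions constant on each of them `R_u` multiplies by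
`E(u)`, so it expands the differences of the normalized indicators by at least `ε`. These
differences have norm at least `1`, while a compact operator makes some of them arbitrarily small;
hence every compact `S` has `‖R_u - S‖ ≥ ε` (`le_essNorm_of_separated`). Working with differences
makes weak convergence of the indicators unnecessary. -/

namespace Orlicz

/-! ### Locality of the conditional expectation and `|E(f)| ≤ E(|f|)`. -/

section ConditionalExpectation

variable {Ω : Type*} {𝒜 : MeasurableSpace Ω} {mΩ : MeasurableSpace Ω} {μ : Measure Ω}

theorem condLExp_indicator (h𝒜 : 𝒜 ≤ mΩ) [SigmaFinite (μ.trim h𝒜)] (X : Ω → ℝ≥0∞) {B : Set Ω}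
    (hB : MeasurableSet[𝒜] B) :
    condLExp 𝒜 μ (B.indicator X) =ᵐ[μ] B.indicator (condLExp 𝒜 μ X) := by
  refine (ae_eq_condLExp h𝒜 μ _ ((measurable_condLExp 𝒜 μ X).indicator hB) fun s hs => ?_).symm
  rw [setLIntegral_indicator (h𝒜 _ hB), setLIntegral_indicator (h𝒜 _ hB),
    setLIntegral_condLExp h𝒜 μ X (hB.inter hs)]

/-- Locality of `E`. It stands in for the pull-out property wherever a function is truncated to an
`𝒜`-set. -/
theorem condLExp_congr_on (h𝒜 : 𝒜 ≤ mΩ) [SigmaFinite (μ.trim h𝒜)] {X Y : Ω → ℝ≥0∞} {B : Set Ω}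
    (hB : MeasurableSet[𝒜] B) (h : ∀ᵐ ω ∂μ, ω ∈ B → X ω = Y ω) :
    ∀ᵐ ω ∂μ, ω ∈ B → condLExp 𝒜 μ X ω = condLExp 𝒜 μ Y ω := by
  have hXY : B.indicator X =ᵐ[μ] B.indicator Y := by
    filter_upwards [h] with ω hω
    by_cases hm : ω ∈ B
    · simp [hm, hω hm]
    · simp [hm]
  filter_upwards [condLExp_indicator h𝒜 X hB, condLExp_indicator h𝒜 Y hB,
    condLExp_congr_ae (mΩ := 𝒜) hXY] with ω h1 h2 h3 hm
  rw [h1, h2] at h3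
  simpa [hm] using h3

theorem condExpC_congr_on (h𝒜 : 𝒜 ≤ mΩ) [SigmaFinite (μ.trim h𝒜)] {f g : Ω → ℂ} {B : Set Ω}
    (hB : MeasurableSet[𝒜] B) (h : ∀ᵐ ω ∂μ, ω ∈ B → f ω = g ω) :
    ∀ᵐ ω ∂μ, ω ∈ B → condExpC 𝒜 μ f ω = condExpC 𝒜 μ g ω := by
  have key : ∀ p : ℂ → ℝ≥0∞, ∀ᵐ ω ∂μ, ω ∈ B →
      condLExp 𝒜 μ (fun ω => p (f ω)) ω = condLExp 𝒜 μ (fun ω => p (g ω)) ω := fun p =>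
    condLExp_congr_on h𝒜 hB (by filter_upwards [h] with ω hω hm; rw [hω hm])
  filter_upwards [key fun z => ENNReal.ofReal z.re, key fun z => ENNReal.ofReal (-z.re),
    key fun z => ENNReal.ofReal z.im, key fun z => ENNReal.ofReal (-z.im)] with ω h1 h2 h3 h4 hm
  simp only [condExpC, condExpReal, h1 hm, h2 hm, h3 hm, h4 hm]

theorem condExpC_zero (μ : Measure Ω) (ω : Ω) : condExpC 𝒜 μ (fun _ => 0) ω = 0 := by
  have h : condLExp 𝒜 μ (fun _ => 0) = 0 := condLExp_zero μ
  apply Complex.ext <;> simp [condExpC, condExpReal, h]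

theorem measurable_condExpC (μ : Measure Ω) (f : Ω → ℂ) : Measurable[𝒜] (condExpC 𝒜 μ f) := by
  have hr : ∀ g : Ω → ℝ, Measurable[𝒜] (condExpReal 𝒜 μ g) := fun g =>
    (measurable_condLExp 𝒜 μ _).ennreal_toReal.sub (measurable_condLExp 𝒜 μ _).ennreal_toReal
  have he : condExpC 𝒜 μ f = fun ω => ((condExpReal 𝒜 μ (fun ω => (f ω).re) ω : ℝ) : ℂ) +
      (condExpReal 𝒜 μ (fun ω => (f ω).im) ω : ℝ) * Complex.I := by
    funext ω
    apply Complex.ext <;> simp [condExpC]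
  rw [he]
  exact (Complex.measurable_ofReal.comp (hr _)).add
    ((Complex.measurable_ofReal.comp (hr _)).mul_const _)

/-- Testing `E(f)` against a constant direction `c`. -/
theorem re_mul_condExpC_le {f : Ω → ℂ} (hf : Conditionable 𝒜 μ f) (c : ℂ) :
    ∀ᵐ ω ∂μ, (c * condExpC 𝒜 μ f ω).re ≤
      ‖c‖ * (condLExp 𝒜 μ (fun ω => ‖f ω‖ₑ) ω).toReal := by
  obtain ⟨hfm, hfin⟩ := hf
  set p : Ω → ℝ≥0∞ := fun ω => ENNReal.ofReal (f ω).re with hp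
  set q : Ω → ℝ≥0∞ := fun ω => ENNReal.ofReal (-(f ω).re) with hq
  set r : Ω → ℝ≥0∞ := fun ω => ENNReal.ofReal (f ω).im with hr
  set s : Ω → ℝ≥0∞ := fun ω => ENNReal.ofReal (-(f ω).im) with hs
  set e : Ω → ℝ≥0∞ := fun ω => ‖f ω‖ₑ with he
  have hre : AEMeasurable (fun ω => (f ω).re) μ :=
    Complex.measurable_re.comp_aemeasurable hfm.aemeasurable
  have him : AEMeasurable (fun ω => (f ω).im) μ :=
    Complex.measurable_im.comp_aemeasurable hfm.aemeasurable
  have mp : AEMeasurable p μ := hre.ennreal_ofReal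
  have mq : AEMeasurable q μ := hre.neg.ennreal_ofReal
  have mr : AEMeasurable r μ := him.ennreal_ofReal
  have ms : AEMeasurable s μ := him.neg.ennreal_ofReal
  have me : AEMeasurable e μ := hfm.enorm
  have le_e : ∀ x : Ω → ℝ, (∀ ω, x ω ≤ ‖f ω‖) →
      ∀ᵐ ω ∂μ, condLExp 𝒜 μ (fun ω => ENNReal.ofReal (x ω)) ω ≠ ∞ := by
    intro x hx
    have hle : (fun ω => ENNReal.ofReal (x ω)) ≤ᵐ[μ] e := ae_of_all _ fun ω => by
      rw [he]
      simp only
      rw [← ofReal_norm]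
      exact ENNReal.ofReal_le_ofReal (hx ω)
    filter_upwards [hfin, condLExp_mono (mΩ := 𝒜) hle] with ω h1 h2
    exact (h2.trans_lt h1).ne
  -- Real coefficients are written as differences of nonnegative ones. The negative terms are then
  -- moved across the inequality, so that `E` is only applied to sums of `[0, ∞]`-valued functions.
  have key : ∀ a₁ a₂ b₁ b₂ k : ℝ≥0, (∀ z : ℂ, ((a₁ : ℝ) - a₂) * z.re + ((b₁ : ℝ) - b₂) * z.im ≤
      k * ‖z‖) → ∀ᵐ ω ∂μ,
      ((a₁ : ℝ) - a₂) * (condExpC 𝒜 μ f ω).re + ((b₁ : ℝ) - b₂) * (condExpC 𝒜 μ f ω).im ≤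
        k * (condLExp 𝒜 μ e ω).toReal := by
    intro a₁ a₂ b₁ b₂ k hk
    have lin : ∀ (a₁ a₂ b₁ b₂ k : ℝ≥0),
        condLExp 𝒜 μ ((a₁ : ℝ≥0∞) • p + ((a₂ : ℝ≥0∞) • q +
          ((b₁ : ℝ≥0∞) • r + ((b₂ : ℝ≥0∞) • s + (k : ℝ≥0∞) • e)))) =ᵐ[μ]
        fun ω => a₁ * condLExp 𝒜 μ p ω + (a₂ * condLExp 𝒜 μ q ω +
          (b₁ * condLExp 𝒜 μ r ω + (b₂ * condLExp 𝒜 μ s ω + k * condLExp 𝒜 μ e ω))) := by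
      intro a₁ a₂ b₁ b₂ k
      filter_upwards [
        condLExp_add_left (mΩ := 𝒜) ((a₂ : ℝ≥0∞) • q +
          ((b₁ : ℝ≥0∞) • r + ((b₂ : ℝ≥0∞) • s + (k : ℝ≥0∞) • e))) (mp.const_smul (a₁ : ℝ≥0∞)),
        condLExp_add_left (mΩ := 𝒜)
          ((b₁ : ℝ≥0∞) • r + ((b₂ : ℝ≥0∞) • s + (k : ℝ≥0∞) • e)) (mq.const_smul (a₂ : ℝ≥0∞)),
        condLExp_add_left (mΩ := 𝒜)
          ((b₂ : ℝ≥0∞) • s + (k : ℝ≥0∞) • e) (mr.const_smul (b₁ : ℝ≥0∞)),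
        condLExp_add_left (mΩ := 𝒜) ((k : ℝ≥0∞) • e) (ms.const_smul (b₂ : ℝ≥0∞)),
        condLExp_smul (mΩ := 𝒜) p mp (a₁ : ℝ≥0∞), condLExp_smul (mΩ := 𝒜) q mq (a₂ : ℝ≥0∞),
        condLExp_smul (mΩ := 𝒜) r mr (b₁ : ℝ≥0∞), condLExp_smul (mΩ := 𝒜) s ms (b₂ : ℝ≥0∞),
        condLExp_smul (mΩ := 𝒜) e me (k : ℝ≥0∞)] with ω h1 h2 h3 h4 h5 h6 h7 h8 h9
      simp only [Pi.add_apply, Pi.smul_apply, smul_eq_mul] at h1 h2 h3 h4 h5 h6 h7 h8 h9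
      rw [h1, h2, h3, h4, h5, h6, h7, h8, h9]
    -- This is `hk (f ω)` with `Re f = p - q`, `Im f = r - s` and every subtraction cleared.
    have hle : ((a₁ : ℝ≥0∞) • p + ((a₂ : ℝ≥0∞) • q +
          ((b₁ : ℝ≥0∞) • r + ((b₂ : ℝ≥0∞) • s + ((0 : ℝ≥0) : ℝ≥0∞) • e)))) ≤
        ((a₂ : ℝ≥0∞) • p + ((a₁ : ℝ≥0∞) • q +
          ((b₂ : ℝ≥0∞) • r + ((b₁ : ℝ≥0∞) • s + (k : ℝ≥0∞) • e)))) := by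
      intro ω
      have h := hk (f ω)
      have h1 : ∀ x : ℝ, ∃ y z : ℝ≥0, ENNReal.ofReal x = y ∧ ENNReal.ofReal (-x) = z ∧
          x = y - z := fun x => ⟨x.toNNReal, (-x).toNNReal, rfl, rfl, by
            rw [Real.coe_toNNReal', Real.coe_toNNReal', max_zero_sub_max_neg_zero_eq_self]⟩
      obtain ⟨y, z, e1, e2, e3⟩ := h1 (f ω).re
      obtain ⟨y', z', e1', e2', e3'⟩ := h1 (f ω).im
      simp only [Pi.add_apply, Pi.smul_apply, smul_eq_mul, hp, hq, hr, hs, he, e1, e2, e1', e2',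
        enorm_eq_nnnorm]
      rw [e3, e3'] at h
      norm_cast
      rw [← NNReal.coe_le_coe]
      push_cast
      linarith
    filter_upwards [condLExp_mono (mΩ := 𝒜) (ae_of_all _ hle), lin a₁ a₂ b₁ b₂ 0,
      lin a₂ a₁ b₂ b₁ k, le_e _ fun ω => Complex.re_le_norm (f ω),
      le_e _ fun ω => (neg_le_abs _).trans (Complex.abs_re_le_norm (f ω)),
      le_e _ fun ω => Complex.im_le_norm (f ω),
      le_e _ fun ω => (neg_le_abs _).trans (Complex.abs_im_le_norm (f ω)), hfin]
      with ω h1 h2 h3 fp fq fr fs fe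
    rw [h2, h3] at h1
    have hE : condExpC 𝒜 μ f ω = ⟨(condLExp 𝒜 μ p ω).toReal - (condLExp 𝒜 μ q ω).toReal,
      (condLExp 𝒜 μ r ω).toReal - (condLExp 𝒜 μ s ω).toReal⟩ := rfl
    rw [hE]
    lift condLExp 𝒜 μ p ω to ℝ≥0 using fp with P hP
    lift condLExp 𝒜 μ q ω to ℝ≥0 using fq with Q hQ
    lift condLExp 𝒜 μ r ω to ℝ≥0 using fr with R hR
    lift condLExp 𝒜 μ s ω to ℝ≥0 using fs with S hS
    lift condLExp 𝒜 μ e ω to ℝ≥0 using fe.ne with T hT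
    norm_cast at h1
    rw [← NNReal.coe_le_coe] at h1
    push_cast at h1
    simp only [ENNReal.coe_toReal]
    linarith
  -- Since `Re (c z) = Re c Re z - Im c Im z`, the coefficient of `Im z` is `-Im c`.
  have hc := key c.re.toNNReal (-c.re).toNNReal (-c.im).toNNReal c.im.toNNReal ‖c‖₊ (by
    intro z
    have h1 := Complex.re_le_norm (c * z)
    rw [norm_mul, Complex.mul_re] at h1
    simp only [Real.coe_toNNReal', coe_nnnorm]
    have h2 := max_zero_sub_max_neg_zero_eq_self (α := ℝ)
    have h3 := h2 (-c.im)
    rw [neg_neg] at h3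
    rw [h2, h3]
    linarith)
  filter_upwards [hc] with ω h
  rw [Complex.mul_re]
  simp only [Real.coe_toNNReal', coe_nnnorm] at h
  have h2 := max_zero_sub_max_neg_zero_eq_self (α := ℝ)
  have h3 := h2 (-c.im)
  rw [neg_neg] at h3
  rw [h2, h3] at h
  linarith

/-- The modulus is recovered from its linear tests. A countable dense set of directions gives one
null set for all of them, and continuity extends the bound to every direction. -/
theorem enorm_condExpC_le {f : Ω → ℂ} (hf : Conditionable 𝒜 μ f) :
    ∀ᵐ ω ∂μ, ‖condExpC 𝒜 μ f ω‖ₑ ≤ condLExp 𝒜 μ (fun ω => ‖f ω‖ₑ) ω := by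
  have h : ∀ᵐ ω ∂μ, ∀ n : ℕ, (TopologicalSpace.denseSeq ℂ n * condExpC 𝒜 μ f ω).re ≤
      ‖TopologicalSpace.denseSeq ℂ n‖ * (condLExp 𝒜 μ (fun ω => ‖f ω‖ₑ) ω).toReal :=
    ae_all_iff.2 fun n => re_mul_condExpC_le hf _
  filter_upwards [h, hf.2] with ω h hfin
  set z := condExpC 𝒜 μ f ω
  set t := (condLExp 𝒜 μ (fun ω => ‖f ω‖ₑ) ω).toReal with ht
  have hall : ∀ c : ℂ, (c * z).re ≤ ‖c‖ * t := fun c =>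
    (isClosed_le (Complex.continuous_re.comp (continuous_id.mul continuous_const))
      (continuous_norm.mul continuous_const)).closure_subset_iff.2
      (range_subset_iff.2 h) (TopologicalSpace.denseRange_denseSeq ℂ c)
  -- The optimal direction gives `|z|² ≤ |z| t`.
  have hz := hall (starRingEnd ℂ z)
  rw [Complex.conj_mul', RCLike.norm_conj, ← Complex.ofReal_pow, Complex.ofReal_re, sq] at hz
  rw [← ofReal_norm, ← ENNReal.ofReal_toReal hfin.ne]
  refine ENNReal.ofReal_le_ofReal ?_
  rcases (norm_nonneg z).eq_or_lt with h0 | h0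
  · rw [← h0]; exact ENNReal.toReal_nonneg
  · exact le_of_mul_le_mul_left hz h0

end ConditionalExpectation

end Orlicz

namespace Orlicz

/-! ### Lattice properties of the Luxemburg norm, truncation, and generalized inverses. -/

section OrliczLemmas

variable {Ω : Type*} {mΩ : MeasurableSpace Ω} {μ : Measure Ω} {Φ : YoungFunction}

theorem norm_le_norm_of_ae_le {f g : OrliczSpace Φ μ}
    (h : ∀ᵐ ω ∂μ, ‖(f : Ω →ₘ[μ] ℂ) ω‖ ≤ ‖(g : Ω →ₘ[μ] ℂ) ω‖) : ‖f‖ ≤ ‖g‖ := by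
  refine le_of_forall_gt_imp_ge_of_dense fun k hk => ?_
  have hk0 : 0 < k := (norm_nonneg g).trans_lt hk
  refine norm_le_of_lintegral_le hk0 (le_trans (lintegral_mono_ae ?_) (lintegral_le_of_norm_lt hk))
  filter_upwards [h] with ω hω
  exact ENNReal.ofReal_le_ofReal (Φ.mono (by positivity) (by gcongr))

theorem mul_norm_le_norm_of_ae_le {f g : OrliczSpace Φ μ} {c : ℝ} (hc : 0 ≤ c)
    (h : ∀ᵐ ω ∂μ, c * ‖(f : Ω →ₘ[μ] ℂ) ω‖ ≤ ‖(g : Ω →ₘ[μ] ℂ) ω‖) : c * ‖f‖ ≤ ‖g‖ := by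
  have e : ‖(c : ℂ) • f‖ = c * ‖f‖ := by
    rw [norm_smul, Complex.norm_real, Real.norm_of_nonneg hc]
  rw [← e]
  refine norm_le_norm_of_ae_le ?_
  filter_upwards [h, AEEqFun.coeFn_smul (c : ℂ) (f : Ω →ₘ[μ] ℂ)] with ω hω h1
  rw [Submodule.coe_smul, h1, Pi.smul_apply, norm_smul, Complex.norm_real, Real.norm_of_nonneg hc]
  exact hω

/-- The class of the characteristic function of a set of finite measure. -/
noncomputable def indicatorOne (Φ : YoungFunction) {B : Set Ω} (hB : MeasurableSet B) (hμ : μ B < ∞) :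
    OrliczSpace Φ μ :=
  ⟨AEEqFun.mk (B.indicator fun _ => (1 : ℂ))
    (stronglyMeasurable_const.indicator hB).aestronglyMeasurable, by
    refine ⟨AEEqFun.aestronglyMeasurable _, 1, one_pos, ?_⟩
    have h : (fun ω => ENNReal.ofReal (Φ (1 * ‖(AEEqFun.mk (B.indicator fun _ => (1 : ℂ))
        (stronglyMeasurable_const.indicator hB).aestronglyMeasurable : Ω →ₘ[μ] ℂ) ω‖))) =ᵐ[μ]
        B.indicator fun _ => ENNReal.ofReal (Φ 1) := by
      filter_upwards [AEEqFun.coeFn_mk (μ := μ) (B.indicator fun _ => (1 : ℂ))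
        (stronglyMeasurable_const.indicator hB).aestronglyMeasurable] with ω hω
      rw [hω]
      by_cases hm : ω ∈ B <;> simp [hm, Φ.map_zero]
    rw [lintegral_congr_ae h, lintegral_indicator hB, setLIntegral_const]
    exact ENNReal.mul_lt_top ENNReal.ofReal_lt_top hμ⟩

theorem coeFn_indicatorOne {B : Set Ω} (hB : MeasurableSet B) (hμ : μ B < ∞) :
    ((indicatorOne Φ hB hμ : Ω →ₘ[μ] ℂ) : Ω → ℂ) =ᵐ[μ] B.indicator fun _ => (1 : ℂ) :=
  AEEqFun.coeFn_mk _ _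

theorem norm_indicatorOne_pos {B : Set Ω} (hB : MeasurableSet B) (hμ : μ B < ∞) (h0 : 0 < μ B) :
    0 < ‖indicatorOne Φ hB hμ‖ := by
  rw [norm_pos_iff]
  intro h
  have h1 := coeFn_indicatorOne (Φ := Φ) hB hμ
  rw [h, Submodule.coe_zero] at h1
  refine h0.ne' (measure_eq_zero_iff_ae_notMem.2 ?_)
  filter_upwards [h1, AEEqFun.coeFn_zero (α := Ω) (β := ℂ) (μ := μ)] with ω h2 h3 hm
  rw [h2, indicator_of_mem hm] at h3
  exact one_ne_zero h3

/-- Multiplication by the characteristic function of a measurable set. -/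
noncomputable def restrictCLM (Φ : YoungFunction) (μ : Measure Ω) {N : Set Ω} (hN : MeasurableSet N) :
    OrliczSpace Φ μ →L[ℂ] OrliczSpace Φ μ :=
  let χ : Ω →ₘ[μ] ℂ := AEEqFun.mk (N.indicator fun _ => (1 : ℂ))
    (stronglyMeasurable_const.indicator hN).aestronglyMeasurable
  have hχ : ∀ f : Ω →ₘ[μ] ℂ, ∀ᵐ ω ∂μ, ‖(χ * f : Ω →ₘ[μ] ℂ) ω‖ ≤ ‖f ω‖ := fun f => by
    filter_upwards [AEEqFun.coeFn_mul χ f, AEEqFun.coeFn_mk (μ := μ) (N.indicator fun _ => (1 : ℂ))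
      (stronglyMeasurable_const.indicator hN).aestronglyMeasurable] with ω h1 h2
    rw [h1, Pi.mul_apply, h2]
    by_cases hm : ω ∈ N <;> simp [hm]
  LinearMap.mkContinuous
    { toFun := fun f => ⟨χ * (f : Ω →ₘ[μ] ℂ), by
        obtain ⟨_, k, hk, hf⟩ := f.2
        refine ⟨AEEqFun.aestronglyMeasurable _, k, hk, (lintegral_mono_ae ?_).trans_lt hf⟩
        filter_upwards [hχ f] with ω hω
        exact ENNReal.ofReal_le_ofReal (Φ.mono (by positivity) (by gcongr))⟩
      map_add' := fun f g => Subtype.ext <| AEEqFun.ext <| by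
        simp only [Submodule.coe_add]
        filter_upwards [AEEqFun.coeFn_mul χ ((f : Ω →ₘ[μ] ℂ) + g),
          AEEqFun.coeFn_add (f : Ω →ₘ[μ] ℂ) g, AEEqFun.coeFn_mul χ (f : Ω →ₘ[μ] ℂ),
          AEEqFun.coeFn_mul χ (g : Ω →ₘ[μ] ℂ),
          AEEqFun.coeFn_add (χ * (f : Ω →ₘ[μ] ℂ)) (χ * g)] with ω h1 h2 h3 h4 h5
        simp only [Pi.mul_apply, Pi.add_apply] at h1 h2 h3 h4 h5
        rw [h1, h2, h5, h3, h4, mul_add]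
      map_smul' := fun c f => Subtype.ext <| AEEqFun.ext <| by
        simp only [Submodule.coe_smul, RingHom.id_apply]
        filter_upwards [AEEqFun.coeFn_mul χ (c • (f : Ω →ₘ[μ] ℂ)),
          AEEqFun.coeFn_smul c (f : Ω →ₘ[μ] ℂ), AEEqFun.coeFn_mul χ (f : Ω →ₘ[μ] ℂ),
          AEEqFun.coeFn_smul c (χ * (f : Ω →ₘ[μ] ℂ))] with ω h1 h2 h3 h4
        simp only [Pi.mul_apply, Pi.smul_apply, smul_eq_mul] at h1 h2 h3 h4
        rw [h1, h2, h4, h3, mul_left_comm] }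
    1 fun f => by
      rw [one_mul]
      exact norm_le_norm_of_ae_le (hχ f)

theorem coeFn_restrictCLM {N : Set Ω} (hN : MeasurableSet N) (f : OrliczSpace Φ μ) :
    ((restrictCLM Φ μ hN f : Ω →ₘ[μ] ℂ) : Ω → ℂ) =ᵐ[μ] N.indicator (f : Ω →ₘ[μ] ℂ) := by
  have h : (restrictCLM Φ μ hN f : Ω →ₘ[μ] ℂ) = AEEqFun.mk (N.indicator fun _ => (1 : ℂ))
    (stronglyMeasurable_const.indicator hN).aestronglyMeasurable * (f : Ω →ₘ[μ] ℂ) := rfl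
  rw [h]
  filter_upwards [AEEqFun.coeFn_mul (AEEqFun.mk (N.indicator fun _ => (1 : ℂ))
    (stronglyMeasurable_const.indicator hN).aestronglyMeasurable) (f : Ω →ₘ[μ] ℂ),
    AEEqFun.coeFn_mk (μ := μ) (N.indicator fun _ => (1 : ℂ))
      (stronglyMeasurable_const.indicator hN).aestronglyMeasurable] with ω h1 h2
  rw [h1, Pi.mul_apply, h2]
  by_cases hm : ω ∈ N <;> simp [hm]

/-- The supremum defining `youngInv` is not known to be attained, so `t` is approached from the
left, where each `s < t` is dominated by a competitor, and continuity of `Φ` finishes. -/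
theorem ofReal_le_of_le_youngInv (Φ : YoungFunction) {t : ℝ} (ht : 0 ≤ t) {y : ℝ≥0∞}
    (h : ENNReal.ofReal t ≤ youngInv Φ y) : ENNReal.ofReal (Φ t) ≤ y := by
  rcases ht.eq_or_lt with rfl | ht
  · simp [Φ.map_zero]
  have hcont : Tendsto (fun s => ENNReal.ofReal (Φ s)) (𝓝[<] t) (𝓝 (ENNReal.ofReal (Φ t))) :=
    ((ENNReal.continuous_ofReal.comp Φ.continuous_toFun).tendsto t).mono_left nhdsWithin_le_nhds
  refine le_of_tendsto hcont ?_
  filter_upwards [Ioo_mem_nhdsLT ht] with s hs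
  have hlt : ENNReal.ofReal s < youngInv Φ y :=
    ((ENNReal.ofReal_lt_ofReal_iff ht).2 hs.2).trans_le h
  simp only [youngInv, lt_iSup_iff] at hlt
  obtain ⟨r, hr, hsr⟩ := hlt
  refine (ENNReal.ofReal_le_ofReal (Φ.mono hs.1.le ?_)).trans hr
  rw [ENNReal.ofReal, ENNReal.coe_lt_coe] at hsr
  exact (Real.le_coe_toNNReal s).trans (NNReal.coe_le_coe.2 hsr.le)

/-- Otherwise `ε` itself competes in the supremum; no monotonicity of `φ` is needed. -/
theorem lt_ofReal_of_youngInv_lt {φ : ℝ → ℝ} {ε : ℝ≥0} {y : ℝ≥0∞}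
    (h : youngInv φ y < ε) : y < ENNReal.ofReal (φ ε) := by
  by_contra hy
  exact (le_iSup₂ (f := fun (t : ℝ≥0) (_ : ENNReal.ofReal (φ t) ≤ y) => (t : ℝ≥0∞)) ε
    (not_lt.1 hy)).not_gt h

theorem ofReal_complementary_zero (Φ : YoungFunction) :
    ENNReal.ofReal (complementary Φ 0) = 0 := by
  refine ENNReal.ofReal_eq_zero.2 (Real.sSup_nonpos ?_)
  rintro _ ⟨x, -, rfl⟩
  simpa using Φ.nonneg x

end OrliczLemmas

/-! ### Compact operators and the essential norm. -/

section EssentialNorm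

variable {X : Type*} [NormedAddCommGroup X] [NormedSpace ℂ X]

theorem essNorm_le {T S : X →L[ℂ] X} (hS : IsCompactOperator S) : essNorm T ≤ ‖T - S‖ :=
  csInf_le ⟨0, by rintro _ ⟨S, -, rfl⟩; exact norm_nonneg _⟩ ⟨S, hS, rfl⟩

/-- The operator factors through a finite-dimensional, hence proper, space. -/
theorem isCompactOperator_of_forall_mem_span {T : X →L[ℂ] X} (v : X)
    (h : ∀ x, T x ∈ Submodule.span ℂ {v}) : IsCompactOperator T := by
  have : ProperSpace (Submodule.span ℂ {v}) := FiniteDimensional.proper ℂ _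
  have h1 : IsCompactOperator (T.codRestrict (Submodule.span ℂ {v}) h) :=
    isCompactOperator_of_locallyCompactSpace_dom (T.codRestrict (Submodule.span ℂ {v}) h)
  exact h1.clm_comp (Submodule.span ℂ {v}).subtypeL

/-- An operator that is bounded below by `ε` on the differences of a uniformly separated sequence
of unit vectors has distance at least `ε` from the compact operators. -/
theorem le_essNorm_of_separated {T : X →L[ℂ] X} {ε : ℝ} (e : ℕ → X)
    (he : ∀ n, ‖e n‖ ≤ 1) (hsep : ∀ n m, n ≠ m → 1 ≤ ‖e n - e m‖)
    (hT : ∀ n m, n ≠ m → ε * ‖e n - e m‖ ≤ ‖T (e n - e m)‖) : ε ≤ essNorm T := by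
  refine le_csInf ⟨_, 0, isCompactOperator_zero, rfl⟩ ?_
  rintro _ ⟨S, hS, rfl⟩
  refine le_of_forall_pos_le_add fun δ hδ => ?_
  obtain ⟨K, hK, hKS⟩ := hS.image_closedBall_subset_compact (f := (S : X →ₗ[ℂ] X)) 1
  obtain ⟨g, -, φ, hφ, hlim⟩ := hK.tendsto_subseq (x := fun n => S (e n)) fun n =>
    hKS ⟨e n, by simpa using he n, rfl⟩
  obtain ⟨N, hN⟩ := Metric.cauchySeq_iff.1 hlim.cauchySeq δ hδ
  have hne : φ N ≠ φ (N + 1) := (hφ N.lt_succ_self).ne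
  have hS' : ‖S (e (φ N) - e (φ (N + 1)))‖ < δ := by
    rw [map_sub, ← dist_eq_norm]
    exact hN N le_rfl (N + 1) N.le_succ
  set h := e (φ N) - e (φ (N + 1))
  have h1 : 1 ≤ ‖h‖ := hsep _ _ hne
  have h2 : ε * ‖h‖ ≤ ‖T h‖ := hT _ _ hne
  have h3 : ‖T h‖ ≤ ‖(T - S) h‖ + ‖S h‖ := by
    have := norm_add_le ((T - S) h) (S h)
    simpa using this
  have h4 := (T - S).le_opNorm h
  -- The error `δ` is absorbed into `δ * ‖h‖` because `1 ≤ ‖h‖`.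
  have h5 : ε * ‖h‖ ≤ (‖T - S‖ + δ) * ‖h‖ := by nlinarith
  exact le_of_mul_le_mul_right h5 (by linarith)

end EssentialNorm

/-! ### Atoms, and splitting off disjoint sets. -/

section Atoms

variable {Ω : Type*} {𝒜 : MeasurableSpace Ω} {mΩ : MeasurableSpace Ω} {μ : Measure Ω}

theorem ConsistsOfFinitelyManyAtoms.union {M N : Set Ω} (hM : ConsistsOfFinitelyManyAtoms 𝒜 μ M)
    (hN : ConsistsOfFinitelyManyAtoms 𝒜 μ N) : ConsistsOfFinitelyManyAtoms 𝒜 μ (M ∪ N) := by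
  classical
  obtain ⟨S, hS, hMS⟩ := hM
  obtain ⟨T, hT, hNT⟩ := hN
  refine ⟨S ∪ T, fun A hA => (Finset.mem_union.1 hA).elim (hS A) (hT A), ?_⟩
  rw [Finset.set_biUnion_union]
  exact hMS.union hNT

/-- `M` is neither null nor an atom, so it splits into two pieces of positive measure. The pieces
cannot both be finite unions of atoms; keep a bad one and discard the other. -/
theorem exists_subset_not_consistsOfFinitelyManyAtoms {M : Set Ω}
    (hM : MeasurableSet[𝒜] M)
    (h : ¬ ConsistsOfFinitelyManyAtoms 𝒜 μ M) : ∃ M' ⊆ M, MeasurableSet[𝒜] M' ∧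
      ¬ ConsistsOfFinitelyManyAtoms 𝒜 μ M' ∧ 0 < μ (M \ M') := by
  have h0 : 0 < μ M := by
    refine pos_iff_ne_zero.2 fun h0 => h ⟨∅, by simp, ?_⟩
    simpa using ae_eq_empty.2 h0
  have hna : ¬ IsAtomOf 𝒜 μ M := fun ha => h ⟨{M}, by simpa using ha, by simpa using EventuallyEq.refl (ae μ) M⟩
  have hF : ∃ F, MeasurableSet[𝒜] F ∧ F ⊆ M ∧ μ F ≠ 0 ∧ μ F ≠ μ M := by
    by_contra hc
    push Not at hc
    exact hna ⟨hM, h0, fun F hF hFM => or_iff_not_imp_left.2 (hc F hF hFM)⟩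
  obtain ⟨F, hF, hFM, hF0, hFne⟩ := hF
  have hdiff : 0 < μ (M \ F) := by
    refine pos_iff_ne_zero.2 fun hz => hFne (le_antisymm (measure_mono hFM) ?_)
    -- Subadditivity rather than subtraction, since `μ M` may be infinite.
    calc μ M ≤ μ (F ∪ M \ F) := measure_mono fun ω hω => by
          by_cases hm : ω ∈ F
          · exact Or.inl hm
          · exact Or.inr ⟨hω, hm⟩
      _ ≤ μ F + μ (M \ F) := measure_union_le _ _
      _ = μ F := by rw [hz, add_zero]
  by_cases hc : ConsistsOfFinitelyManyAtoms 𝒜 μ F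
  · refine ⟨M \ F, sdiff_subset, hM.diff hF, fun hd => h ?_, ?_⟩
    · rw [← union_sdiff_cancel hFM]
      exact hc.union hd
    · rw [sdiff_sdiff_cancel_left hFM]
      exact pos_iff_ne_zero.2 hF0
  · exact ⟨F, hFM, hF, hc, hdiff⟩

/-- Iterate the splitting: the discarded pieces are disjoint with positive measure, and σ-finiteness
on `𝒜` shrinks each to finite measure. -/
theorem exists_seq_disjoint_of_not_consistsOfFinitelyManyAtoms (h𝒜 : 𝒜 ≤ mΩ)
    [SigmaFinite (μ.trim h𝒜)] {N : Set Ω} (hN : MeasurableSet[𝒜] N)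
    (h : ¬ ConsistsOfFinitelyManyAtoms 𝒜 μ N) : ∃ B : ℕ → Set Ω,
      (∀ n, MeasurableSet[𝒜] (B n)) ∧ (∀ n, B n ⊆ N) ∧ (∀ n, 0 < μ (B n)) ∧
      (∀ n, μ (B n) < ∞) ∧ Pairwise fun n m => Disjoint (B n) (B m) := by
  let P := {M : Set Ω // MeasurableSet[𝒜] M ∧ M ⊆ N ∧ ¬ ConsistsOfFinitelyManyAtoms 𝒜 μ M}
  have step : ∀ M : P, ∃ M' : P, M'.1 ⊆ M.1 ∧ 0 < μ (M.1 \ M'.1) := fun M => by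
    obtain ⟨M', h1, h2, h3, h4⟩ :=
      exists_subset_not_consistsOfFinitelyManyAtoms M.2.1 M.2.2.2
    exact ⟨⟨M', h2, h1.trans M.2.2.1, h3⟩, h1, h4⟩
  choose next hsub hpos using step
  let M : ℕ → P := fun n => next^[n] ⟨N, hN, Subset.rfl, h⟩
  have hM : ∀ n, M (n + 1) = next (M n) := fun n => Function.iterate_succ_apply' _ _ _
  have hanti : Antitone fun n => (M n).1 := antitone_nat_of_succ_le fun n => by
    rw [hM]; exact hsub _
  have hex : ∀ n, ∃ B ⊆ (M n).1 \ (M (n + 1)).1, MeasurableSet[𝒜] B ∧ 0 < μ B ∧ μ B < ∞ := by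
    intro n
    have hD : MeasurableSet[𝒜] ((M n).1 \ (M (n + 1)).1) := (M n).2.1.diff (M (n + 1)).2.1
    have hp : 0 < μ.trim h𝒜 ((M n).1 \ (M (n + 1)).1) := by
      rw [trim_measurableSet_eq h𝒜 hD, hM]
      exact hpos _
    obtain ⟨B, hB, hBD, h0, hfin⟩ :=
      Measure.exists_subset_measure_lt_top (μ := μ.trim h𝒜) hD hp
    rw [trim_measurableSet_eq h𝒜 hB] at h0 hfin
    exact ⟨B, hBD, hB, h0, hfin⟩
  choose B hBD hB h0 hfin using hex
  refine ⟨B, hB, fun n => (hBD n).trans (sdiff_subset.trans (M n).2.2.1), h0, hfin, ?_⟩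
  refine (pairwise_disjoint_on B).2 fun n m hnm => ?_
  refine disjoint_left.2 fun ω h1 h2 => (hBD n h1).2 (hanti hnm (hBD m h2).1)

/-- By σ-finiteness on `𝒜` an atom has an `𝒜`-subset of positive finite measure, which must carry
the measure of the whole atom. -/
theorem IsAtomOf.measure_lt_top (h𝒜 : 𝒜 ≤ mΩ) [SigmaFinite (μ.trim h𝒜)] {A : Set Ω}
    (hA : IsAtomOf 𝒜 μ A) : μ A < ∞ := by
  have hp : 0 < μ.trim h𝒜 A := by
    rw [trim_measurableSet_eq h𝒜 hA.1]
    exact hA.2.1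
  obtain ⟨B, hB, hBA, h0, hfin⟩ := Measure.exists_subset_measure_lt_top (μ := μ.trim h𝒜) hA.1 hp
  rw [trim_measurableSet_eq h𝒜 hB] at h0 hfin
  rcases hA.2.2 B hB hBA with h | h
  · exact absurd h h0.ne'
  · rwa [← h]

/-- Each event `g ∈ U` obeys a zero-one law on the atom, and countably many Borel sets separate the
points of `ℂ`. -/
theorem IsAtomOf.ae_const (h𝒜 : 𝒜 ≤ mΩ) [SigmaFinite (μ.trim h𝒜)] {A : Set Ω}
    (hA : IsAtomOf 𝒜 μ A) {g : Ω → ℂ} (hg : Measurable[𝒜] g) :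
    ∃ c : ℂ, ∀ᵐ ω ∂μ, ω ∈ A → g ω = c := by
  have h : ∀ U : Set ℂ, MeasurableSet U →
      (∀ᵐ ω ∂(μ.restrict A), g ω ∈ U) ∨ (∀ᵐ ω ∂(μ.restrict A), g ω ∉ U) := by
    intro U hU
    have hgU : MeasurableSet[𝒜] (g ⁻¹' U) := hg hU
    rcases hA.2.2 (A ∩ g ⁻¹' U) (hA.1.inter hgU) inter_subset_left with h | h
    · right
      rw [ae_restrict_iff' (h𝒜 _ hA.1)]
      filter_upwards [measure_eq_zero_iff_ae_notMem.1 h] with ω h1 h2 h3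
      exact h1 ⟨h2, h3⟩
    · left
      rw [ae_restrict_iff' (h𝒜 _ hA.1)]
      have hz : μ (A \ (A ∩ g ⁻¹' U)) = 0 := by
        rw [measure_sdiff inter_subset_left (h𝒜 _ (hA.1.inter hgU)).nullMeasurableSet
          (h ▸ (hA.measure_lt_top h𝒜).ne), h, tsub_self]
      filter_upwards [measure_eq_zero_iff_ae_notMem.1 hz] with ω h1 h2
      by_contra h3
      exact h1 ⟨h2, fun h4 => h3 h4.2⟩
  obtain ⟨c, hc⟩ := Filter.exists_eventuallyEq_const_of_forall_separating
    (l := ae (μ.restrict A)) (f := g) MeasurableSet h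
  exact ⟨c, (ae_restrict_iff' (h𝒜 _ hA.1)).1 hc⟩

end Atoms

end Orlicz

namespace Orlicz

/-! ### The two estimates for `R_u`. -/

section Operator

variable {Ω : Type*} {𝒜 : MeasurableSpace Ω} {mΩ : MeasurableSpace Ω} {μ : Measure Ω}
  {Φ : YoungFunction} {u : Ω → ℂ} {R : OrliczSpace Φ μ →L[ℂ] OrliczSpace Φ μ}

/-- On `𝒜`-measurable characteristic functions, `R_u` is multiplication by `E(u)`. -/
theorem IsWCT.apply_indicatorOne (h𝒜 : 𝒜 ≤ mΩ) [SigmaFinite (μ.trim h𝒜)] (hR : IsWCT 𝒜 u R)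
    {B : Set Ω} (hB : MeasurableSet[𝒜] B) (hμ : μ B < ∞) :
    ((R (indicatorOne Φ (h𝒜 _ hB) hμ) : Ω →ₘ[μ] ℂ) : Ω → ℂ) =ᵐ[μ]
      B.indicator (condExpC 𝒜 μ u) := by
  have h := coeFn_indicatorOne (Φ := Φ) (h𝒜 _ hB) hμ
  -- Locality is used on `B` and on `Bᶜ`, so no integrability of `u` has to be checked.
  have h1 := condExpC_congr_on (f := fun ω => u ω * (indicatorOne Φ (h𝒜 _ hB) hμ : Ω →ₘ[μ] ℂ) ω)
    (g := u) h𝒜 hB (by filter_upwards [h] with ω hω hm; simp [hω, hm])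
  have h2 := condExpC_congr_on (f := fun ω => u ω * (indicatorOne Φ (h𝒜 _ hB) hμ : Ω →ₘ[μ] ℂ) ω)
    (g := fun _ => 0) h𝒜 hB.compl
    (by filter_upwards [h] with ω hω hm; simp [hω, indicator_of_notMem hm])
  filter_upwards [(hR (indicatorOne Φ (h𝒜 _ hB) hμ)).2, h1, h2] with ω e e1 e2
  rw [e]
  by_cases hm : ω ∈ B
  · rw [e1 hm, indicator_of_mem hm]
  · rw [e2 hm, indicator_of_notMem hm, condExpC_zero]

/-- If `{|E(u)| ≥ ε}` does not consist of finitely many `𝒜`-atoms, then `‖R_u‖_e ≥ ε`. -/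
theorem IsWCT.le_essNorm (h𝒜 : 𝒜 ≤ mΩ) [SigmaFinite (μ.trim h𝒜)] (hR : IsWCT 𝒜 u R) {ε : ℝ≥0}
    (hN : ¬ ConsistsOfFinitelyManyAtoms 𝒜 μ {ω | (ε : ℝ≥0∞) ≤ ‖condExpC 𝒜 μ u ω‖ₑ}) :
    (ε : ℝ) ≤ essNorm R := by
  have hNm : MeasurableSet[𝒜] {ω | (ε : ℝ≥0∞) ≤ ‖condExpC 𝒜 μ u ω‖ₑ} :=
    measurable_enorm.comp (measurable_condExpC μ u) measurableSet_Ici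
  obtain ⟨B, hB, hBN, h0, hfin, hdisj⟩ :=
    exists_seq_disjoint_of_not_consistsOfFinitelyManyAtoms h𝒜 hNm hN
  set χ : ℕ → OrliczSpace Φ μ := fun n => indicatorOne Φ (h𝒜 _ (hB n)) (hfin n) with hχ
  have hχ0 : ∀ n, 0 < ‖χ n‖ := fun n => norm_indicatorOne_pos _ _ (h0 n)
  set a : ℕ → ℂ := fun n => ((‖χ n‖⁻¹ : ℝ) : ℂ) with ha
  have hnorm : ∀ n, ‖a n • χ n‖ = 1 := fun n => by
    rw [norm_smul, ha]
    simp only [Complex.norm_real, norm_inv, norm_norm]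
    exact inv_mul_cancel₀ (hχ0 n).ne'
  have hval : ∀ n, ((a n • χ n : OrliczSpace Φ μ) : Ω →ₘ[μ] ℂ) =ᵐ[μ]
      (B n).indicator fun _ => a n := fun n => by
    rw [Submodule.coe_smul]
    filter_upwards [AEEqFun.coeFn_smul (a n) (χ n : Ω →ₘ[μ] ℂ),
      coeFn_indicatorOne (Φ := Φ) (h𝒜 _ (hB n)) (hfin n)] with ω h1 h2
    rw [h1, Pi.smul_apply, h2]
    by_cases hm : ω ∈ B n <;> simp [hm]
  have hRval : ∀ n, ((R (a n • χ n) : OrliczSpace Φ μ) : Ω →ₘ[μ] ℂ) =ᵐ[μ]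
      (B n).indicator fun ω => a n * condExpC 𝒜 μ u ω := fun n => by
    rw [map_smul, Submodule.coe_smul]
    filter_upwards [AEEqFun.coeFn_smul (a n) (R (χ n) : Ω →ₘ[μ] ℂ),
      hR.apply_indicatorOne h𝒜 (hB n) (hfin n)] with ω h1 h2
    rw [h1, Pi.smul_apply, h2]
    by_cases hm : ω ∈ B n <;> simp [hm]
  have hsub : ∀ n m, (((a n • χ n - a m • χ m : OrliczSpace Φ μ)) : Ω →ₘ[μ] ℂ) =ᵐ[μ]
      fun ω => (B n).indicator (fun _ => a n) ω - (B m).indicator (fun _ => a m) ω := fun n m => by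
    rw [Submodule.coe_sub]
    filter_upwards [AEEqFun.coeFn_sub ((a n • χ n : OrliczSpace Φ μ) : Ω →ₘ[μ] ℂ)
      (a m • χ m : OrliczSpace Φ μ), hval n, hval m] with ω h1 h2 h3
    rw [h1, Pi.sub_apply, h2, h3]
  refine le_essNorm_of_separated (fun n => a n • χ n) (fun n => (hnorm n).le)
    (fun n m hnm => ?_) fun n m hnm => mul_norm_le_norm_of_ae_le ε.2 ?_
  -- By disjointness the difference coincides with its first term on `B n`, so it dominates that
  -- unit vector.
  · rw [← hnorm n]
    refine norm_le_norm_of_ae_le ?_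
    filter_upwards [hval n, hsub n m] with ω h1 h2
    rw [h1, h2]
    by_cases hm : ω ∈ B n
    · have : ω ∉ B m := disjoint_left.1 (hdisj hnm) hm
      simp [hm, this]
    · simp [hm]
  · rw [map_sub, Submodule.coe_sub _ (R (a n • χ n))]
    filter_upwards [hsub n m, AEEqFun.coeFn_sub (R (a n • χ n) : Ω →ₘ[μ] ℂ) (R (a m • χ m)),
      hRval n, hRval m] with ω h1 h2 h3 h4
    have hE : ω ∈ B n ∪ B m → (ε : ℝ) ≤ ‖condExpC 𝒜 μ u ω‖ := fun hm => by
      have h5 : (ε : ℝ≥0∞) ≤ ‖condExpC 𝒜 μ u ω‖ₑ := hm.elim (fun h => hBN n h) fun h => hBN m h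
      rw [enorm_eq_nnnorm, ENNReal.coe_le_coe] at h5
      exact h5
    rw [h2, Pi.sub_apply, h3, h4, h1]
    by_cases hm : ω ∈ B n
    · have hm' : ω ∉ B m := disjoint_left.1 (hdisj hnm) hm
      simp only [indicator_of_mem hm, indicator_of_notMem hm', sub_zero, norm_mul]
      rw [mul_comm]
      exact mul_le_mul_of_nonneg_left (hE (Or.inl hm)) (norm_nonneg _)
    · by_cases hm' : ω ∈ B m
      · simp only [indicator_of_mem hm', indicator_of_notMem hm, zero_sub, norm_neg, norm_mul]
        rw [mul_comm]
        exact mul_le_mul_of_nonneg_left (hE (Or.inr hm')) (norm_nonneg _)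
      · simp [hm, hm']

/-- Restricting `R_u` to finitely many `𝒜`-atoms gives a compact (finite rank) operator. -/
theorem IsWCT.isCompactOperator_restrict (h𝒜 : 𝒜 ≤ mΩ) [SigmaFinite (μ.trim h𝒜)]
    (hR : IsWCT 𝒜 u R) (S : Finset (Set Ω)) (hS : ∀ A ∈ S, IsAtomOf 𝒜 μ A)
    (hU : MeasurableSet[𝒜] (⋃ A ∈ S, A)) :
    IsCompactOperator ((restrictCLM Φ μ (h𝒜 _ hU)).comp R) := by
  classical
  induction S using Finset.induction_on with
  | empty =>
    have h : (restrictCLM Φ μ (h𝒜 _ hU)).comp R = 0 := by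
      refine ContinuousLinearMap.ext fun f => Subtype.ext (AEEqFun.ext ?_)
      filter_upwards [coeFn_restrictCLM (h𝒜 _ hU) (R f),
        AEEqFun.coeFn_zero (α := Ω) (β := ℂ) (μ := μ)] with ω h1 h2
      simp only [ContinuousLinearMap.comp_apply, _root_.zero_apply,
        Submodule.coe_zero, h1, h2]
      simp
    rw [h]
    exact isCompactOperator_zero
  | insert A S hAS ih =>
    have hA := hS A (Finset.mem_insert_self A S)
    have hV : MeasurableSet[𝒜] (⋃ A ∈ S, A) :=
      S.measurableSet_biUnion fun B hB => (hS B (Finset.mem_insert_of_mem hB)).1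
    set V : Set Ω := ⋃ A ∈ S, A with hVdef
    -- The atoms in `S` may overlap, so only the new part `A \ V` is added. There `E(u f)` is a
    -- constant `c` depending on `f`, so the range lies on the line of one indicator.
    have hD : MeasurableSet[𝒜] (A \ V) := hA.1.diff hV
    have hDfin : μ (A \ V) < ∞ := (measure_mono sdiff_subset).trans_lt (hA.measure_lt_top h𝒜)
    have hsum : (restrictCLM Φ μ (h𝒜 _ hU)).comp R =
        (restrictCLM Φ μ (h𝒜 _ hV)).comp R + (restrictCLM Φ μ (h𝒜 _ hD)).comp R := by
      refine ContinuousLinearMap.ext fun f => Subtype.ext (AEEqFun.ext ?_)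
      simp only [ContinuousLinearMap.comp_apply, _root_.add_apply, Submodule.coe_add]
      filter_upwards [coeFn_restrictCLM (h𝒜 _ hU) (R f), coeFn_restrictCLM (h𝒜 _ hV) (R f),
        coeFn_restrictCLM (h𝒜 _ hD) (R f),
        AEEqFun.coeFn_add (restrictCLM Φ μ (h𝒜 _ hV) (R f) : Ω →ₘ[μ] ℂ)
          (restrictCLM Φ μ (h𝒜 _ hD) (R f))] with ω h1 h2 h3 h4
      rw [h1, h4, Pi.add_apply, h2, h3, Finset.set_biUnion_insert, ← hVdef]
      by_cases hm : ω ∈ V <;> by_cases hm' : ω ∈ A <;> simp [hm, hm', indicator]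
    rw [hsum]
    refine (ih (fun B hB => hS B (Finset.mem_insert_of_mem hB)) hV).add ?_
    refine isCompactOperator_of_forall_mem_span (indicatorOne Φ (h𝒜 _ hD) hDfin) fun f => ?_
    obtain ⟨c, hc⟩ := hA.ae_const h𝒜
      (measurable_condExpC μ fun ω => u ω * (f : Ω →ₘ[μ] ℂ) ω)
    refine Submodule.mem_span_singleton.2 ⟨c, Subtype.ext (AEEqFun.ext ?_)⟩
    rw [Submodule.coe_smul, ContinuousLinearMap.comp_apply]
    filter_upwards [coeFn_restrictCLM (h𝒜 _ hD) (R f), (hR f).2, hc,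
      AEEqFun.coeFn_smul c (indicatorOne Φ (h𝒜 _ hD) hDfin : Ω →ₘ[μ] ℂ),
      coeFn_indicatorOne (Φ := Φ) (h𝒜 _ hD) hDfin] with ω h1 h2 h3 h4 h5
    rw [h1, h4, Pi.smul_apply, h5]
    by_cases hm : ω ∈ A \ V
    · simp only [indicator_of_mem hm, h2, h3 hm.1, smul_eq_mul, mul_one]
    · simp only [indicator_of_notMem hm, smul_zero]

/-- The GCH-inequality for `g = u` on an `𝒜`-measurable set on which `Φ*⁻¹(E(Φ*(|u|))) < ε`. -/
theorem GCHInequality.condLExp_enorm_mul_le (h𝒜 : 𝒜 ≤ mΩ) [SigmaFinite (μ.trim h𝒜)] {C : ℝ}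
    (hC : GCHInequality 𝒜 μ Φ C) (hu : AEStronglyMeasurable u μ) {ε : ℝ≥0} {V : Set Ω}
    (hV : MeasurableSet[𝒜] V)
    (hε : ∀ᵐ ω ∂μ, ω ∈ V → condYoung 𝒜 μ (complementary Φ) u ω < ε) {f : Ω → ℂ}
    (hf : MemOrlicz Φ μ f) :
    ∀ᵐ ω ∂μ, ω ∈ V → condLExp 𝒜 μ (fun ω => ‖u ω * f ω‖ₑ) ω ≤
      ENNReal.ofReal C * ε * condYoung 𝒜 μ Φ f ω := by
  set ψ : Ω → ℝ≥0∞ := fun ω => ENNReal.ofReal (complementary Φ ‖u ω‖) with hψ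
  have hlt : ∀ᵐ ω ∂μ, ω ∈ V → condLExp 𝒜 μ ψ ω ≤ ENNReal.ofReal (complementary Φ ε) := by
    filter_upwards [hε] with ω hω hm
    exact (lt_ofReal_of_youngInv_lt (hω hm)).le
  -- The function `u` need not lie in `L^{Φ*}`, so it is truncated to `V` intersected with an
  -- `𝒜`-set of finite measure. There `E(Φ*(|u|)) ≤ Φ*(ε)` makes the modular finite, and locality
  -- removes the truncation.
  have hn : ∀ n : ℕ, ∀ᵐ ω ∂μ, ω ∈ V ∩ spanningSets (μ.trim h𝒜) n →
      condLExp 𝒜 μ (fun ω => ‖u ω * f ω‖ₑ) ω ≤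
        ENNReal.ofReal C * ε * condYoung 𝒜 μ Φ f ω := by
    intro n
    have hs : MeasurableSet[𝒜] (spanningSets (μ.trim h𝒜) n) := measurableSet_spanningSets _ n
    set B := V ∩ spanningSets (μ.trim h𝒜) n with hBdef
    have hB : MeasurableSet[𝒜] B := hV.inter hs
    have hBfin : μ B < ∞ := by
      refine (measure_mono inter_subset_right).trans_lt ?_
      rw [← trim_measurableSet_eq h𝒜 hs]
      exact measure_spanningSets_lt_top _ n
    have hg : MemOrlicz (complementary Φ) μ (B.indicator u) := by
      refine ⟨hu.indicator (h𝒜 _ hB), 1, one_pos, ?_⟩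
      have he : (fun ω => ENNReal.ofReal (complementary Φ (1 * ‖B.indicator u ω‖))) =
          B.indicator ψ := by
        funext ω
        by_cases hm : ω ∈ B <;> simp [hm, hψ, ofReal_complementary_zero]
      rw [he, lintegral_indicator (h𝒜 _ hB), ← setLIntegral_condLExp h𝒜 μ ψ hB]
      refine (setLIntegral_mono_ae' (h𝒜 _ hB)
        (g := fun _ => ENNReal.ofReal (complementary Φ ε)) ?_).trans_lt ?_
      · filter_upwards [hlt] with ω hω hm using hω hm.1
      · rw [setLIntegral_const]
        exact ENNReal.mul_lt_top ENNReal.ofReal_lt_top hBfin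
    have h1 := condLExp_congr_on (μ := μ) (X := fun ω => ‖f ω * B.indicator u ω‖ₑ)
      (Y := fun ω => ‖u ω * f ω‖ₑ) h𝒜 hB
      (ae_of_all _ fun ω hm => by simp only [indicator_of_mem hm, mul_comm])
    have h2 := condLExp_congr_on (μ := μ)
      (X := fun ω => ENNReal.ofReal (complementary Φ ‖B.indicator u ω‖)) (Y := ψ) h𝒜 hB
      (ae_of_all _ fun ω hm => by simp only [indicator_of_mem hm, hψ])
    filter_upwards [hC f (B.indicator u) hf hg, h1, h2, hε] with ω e e1 e2 e3 hm
    rw [e1 hm] at e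
    refine e.trans ?_
    have e4 : condYoung 𝒜 μ (complementary Φ) (B.indicator u) ω ≤ ε := by
      rw [condYoung, e2 hm]
      exact (e3 hm.1).le
    calc _ ≤ ENNReal.ofReal C * condYoung 𝒜 μ Φ f ω * ε := by gcongr
      _ = _ := by ring
  filter_upwards [ae_all_iff.2 hn] with ω hω hm
  have hmem : ω ∈ ⋃ n, spanningSets (μ.trim h𝒜) n := by
    rw [iUnion_spanningSets]
    exact mem_univ ω
  obtain ⟨n, hn⟩ := mem_iUnion.1 hmem
  exact hω n ⟨hm, hn⟩

/-- Where `Φ*⁻¹(E(Φ*(|u|))) < ε`, the operator `R_u` has norm at most `C ε`. -/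
theorem IsWCT.norm_restrict_le (h𝒜 : 𝒜 ≤ mΩ) [SigmaFinite (μ.trim h𝒜)]
    (hR : IsWCT 𝒜 u R) (hu : AEStronglyMeasurable u μ) {C : ℝ} (hC0 : 0 < C)
    (hC : GCHInequality 𝒜 μ Φ C) {ε : ℝ≥0} (hε0 : 0 < ε) {V : Set Ω} (hV : MeasurableSet[𝒜] V)
    (hε : ∀ᵐ ω ∂μ, ω ∈ V → condYoung 𝒜 μ (complementary Φ) u ω < ε) :
    ‖(restrictCLM Φ μ (h𝒜 _ hV)).comp R‖ ≤ C * ε := by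
  have hCε : 0 < C * ε := mul_pos hC0 hε0
  have hunit : ∀ f : OrliczSpace Φ μ, ‖f‖ < 1 →
      ‖((restrictCLM Φ μ (h𝒜 _ hV)).comp R) f‖ ≤ C * ε := by
    intro f hf
    have hf1 := lintegral_le_of_norm_lt hf
    simp only [inv_one, one_mul] at hf1
    refine norm_le_of_lintegral_le hCε (le_trans ?_ hf1)
    -- Since `E` preserves integrals, it suffices to compare with `E(Φ(|f|))` pointwise.
    rw [← lintegral_condLExp h𝒜 μ fun ω => ENNReal.ofReal (Φ ‖(f : Ω →ₘ[μ] ℂ) ω‖)]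
    refine lintegral_mono_ae ?_
    rw [ContinuousLinearMap.comp_apply]
    filter_upwards [coeFn_restrictCLM (h𝒜 _ hV) (R f), (hR f).2, enorm_condExpC_le (hR f).1,
      hC.condLExp_enorm_mul_le h𝒜 hu hV hε f.2] with ω h1 h2 h3 h4
    rw [h1]
    by_cases hm : ω ∈ V
    · rw [indicator_of_mem hm, h2]
      refine ofReal_le_of_le_youngInv Φ (by positivity) ?_
      rw [← div_eq_inv_mul, ENNReal.ofReal_div_of_pos hCε]
      refine ENNReal.div_le_of_le_mul' ?_
      rw [ofReal_norm, ENNReal.ofReal_mul hC0.le, ENNReal.ofReal_coe_nnreal]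
      exact h3.trans (h4 hm)
    · simp [indicator_of_notMem hm, Φ.map_zero]
  refine ContinuousLinearMap.opNorm_le_bound _ hCε.le fun f => ?_
  refine le_of_forall_pos_le_add fun δ hδ => ?_
  -- Dividing by `k > ‖f‖` gives norm below `1` even when `f = 0`; the excess is chosen to cost
  -- exactly `δ` after multiplication by `C * ε`.
  set k : ℝ := ‖f‖ + δ / (C * ε) with hk
  have hδ' : 0 < δ / (C * ε) := by positivity
  have hk0 : 0 < k := by positivity
  have hfk : f = (k : ℂ) • ((k : ℂ)⁻¹ • f) :=
    (smul_inv_smul₀ (Complex.ofReal_ne_zero.2 hk0.ne') f).symm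
  have h1 := hunit ((k : ℂ)⁻¹ • f) (by
    rw [norm_smul, norm_inv, Complex.norm_real, Real.norm_of_nonneg hk0.le, inv_mul_lt_one₀ hk0]
    linarith)
  rw [hfk, map_smul, ← hfk, norm_smul, Complex.norm_real, Real.norm_of_nonneg hk0.le]
  calc _ ≤ k * (C * ε) := by gcongr
    _ = C * ε * ‖f‖ + δ := by rw [hk]; field_simp

/-- If `{Φ*⁻¹(E(Φ*(|u|))) ≥ ε}` consists of finitely many `𝒜`-atoms, then `‖R_u‖_e ≤ C ε`. -/
theorem IsWCT.essNorm_le (h𝒜 : 𝒜 ≤ mΩ) [SigmaFinite (μ.trim h𝒜)]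
    (hR : IsWCT 𝒜 u R) (hu : AEStronglyMeasurable u μ) {C : ℝ} (hC0 : 0 < C)
    (hC : GCHInequality 𝒜 μ Φ C) {ε : ℝ≥0} (hε0 : 0 < ε)
    (hN : ConsistsOfFinitelyManyAtoms 𝒜 μ
      {ω | (ε : ℝ≥0∞) ≤ condYoung 𝒜 μ (complementary Φ) u ω}) :
    essNorm R ≤ C * ε := by
  obtain ⟨S, hS, hNS⟩ := hN
  have hU : MeasurableSet[𝒜] (⋃ A ∈ S, A) := S.measurableSet_biUnion fun A hA => (hS A hA).1
  -- The truncation is to the complement of the union of atoms, which is in `𝒜` and a.e. equal to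
  -- the sublevel set.
  have hlt : ∀ᵐ ω ∂μ, ω ∈ (⋃ A ∈ S, A)ᶜ → condYoung 𝒜 μ (complementary Φ) u ω < ε := by
    filter_upwards [hNS.mem_iff] with ω hω hm
    exact not_le.1 fun h => hm (hω.1 h)
  have hdiff : R - (restrictCLM Φ μ (h𝒜 _ hU)).comp R =
      (restrictCLM Φ μ (h𝒜 _ hU.compl)).comp R := by
    refine ContinuousLinearMap.ext fun f => Subtype.ext (AEEqFun.ext ?_)
    simp only [ContinuousLinearMap.comp_apply, _root_.sub_apply, Submodule.coe_sub]
    filter_upwards [coeFn_restrictCLM (h𝒜 _ hU) (R f), coeFn_restrictCLM (h𝒜 _ hU.compl) (R f),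
      AEEqFun.coeFn_sub (R f : Ω →ₘ[μ] ℂ) (restrictCLM Φ μ (h𝒜 _ hU) (R f))] with ω h1 h2 h3
    rw [h3, Pi.sub_apply, h1, h2]
    by_cases hm : ω ∈ ⋃ A ∈ S, A
    · rw [indicator_of_mem hm, indicator_of_notMem (notMem_compl_iff.2 hm), sub_self]
    · rw [indicator_of_notMem hm, indicator_of_mem (mem_compl hm), sub_zero]
  refine (Orlicz.essNorm_le (hR.isCompactOperator_restrict h𝒜 S hS hU)).trans ?_
  rw [hdiff]
  exact hR.norm_restrict_le h𝒜 hu hC0 hC hε0 hU.compl hlt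

end Operator

end Orlicz

/-! ### Passing from a fixed level `ε` to the thresholds. -/

theorem theorem3p3 {Ω : Type*} (𝒜 : MeasurableSpace Ω) [mΩ : MeasurableSpace Ω]
    (μ : Measure Ω) [SigmaFinite μ] (h𝒜 : 𝒜 ≤ mΩ) [SigmaFinite (μ.trim h𝒜)]
    (Φ : Orlicz.YoungFunction) (u : Ω → ℂ) (hu : Measurable u)
    (R : Orlicz.OrliczSpace Φ μ →L[ℂ] Orlicz.OrliczSpace Φ μ) (hR : Orlicz.IsWCT 𝒜 u R) :
    (∀ C : ℝ, 0 < C → Orlicz.GCHInequality 𝒜 μ Φ C →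
      ENNReal.ofReal (Orlicz.essNorm R) ≤
        ENNReal.ofReal C *
          Orlicz.atomicThreshold 𝒜 μ (Orlicz.condYoung 𝒜 μ (Orlicz.complementary Φ) u)) ∧
    (∀ (ι : Type) [Countable ι] (A : ι → Set Ω), Orlicz.IsAtomEnumeration 𝒜 μ A →
      (Tendsto (fun i => μ (A i)) cofinite (𝓝 0) ∨
        ¬ ∃ k : ℕ → ι, Function.Injective k ∧
          ∃ L : ℝ, Tendsto (fun n => (μ (A (k n))).toReal) atTop (𝓝 L)) →
      Orlicz.atomicThreshold 𝒜 μ (fun ω => ‖Orlicz.condExpC 𝒜 μ u ω‖ₑ) ≤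
        ENNReal.ofReal (Orlicz.essNorm R)) := by
  refine ⟨fun C hC0 hC => ?_, fun ι _ A _ _ => ?_⟩
  · rw [Orlicz.atomicThreshold]
    simp only [ENNReal.mul_iInf_of_ne (ENNReal.ofReal_pos.2 hC0).ne' ENNReal.ofReal_ne_top]
    -- Multiplication by `0 < C < ∞` commutes with the infimum, including the empty one, where both
    -- sides are `∞`.
    refine le_iInf₂ fun ε hε => ?_
    rw [← ENNReal.ofReal_coe_nnreal, ← ENNReal.ofReal_mul hC0.le]
    exact ENNReal.ofReal_le_ofReal
      (hR.essNorm_le h𝒜 hu.aestronglyMeasurable hC0 hC hε.1 hε.2)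
  · by_contra hlt
    -- An `ε` strictly below the threshold cannot compete in its infimum, so its level set is not a
    -- finite union of atoms. This also covers an infinite threshold.
    obtain ⟨ε, h1, h2⟩ := ENNReal.lt_iff_exists_nnreal_btwn.1 (not_le.1 hlt)
    have hε0 : 0 < ε := ENNReal.coe_pos.1 (zero_le.trans_lt h1)
    refine h1.not_ge ?_
    rw [← ENNReal.ofReal_coe_nnreal]
    refine ENNReal.ofReal_le_ofReal (hR.le_essNorm h𝒜 fun hN => h2.not_ge ?_)
    exact iInf₂_le (f := fun (ε : ℝ≥0) (_ : 0 < ε ∧ _) => (ε : ℝ≥0∞)) ε ⟨hε0, hN⟩
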